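/- Theorem 3.4: Let $n\ge 1$. Let $B_n$ be the linear polyomino chain with $n$ squares, i.e. the graph on vertices $u_1,\dots,u_{n+1},v_1,\dots,v_{n+1}$ with edges $u_iu_{i+1}$, $v_iv_{i+1}$ $(1\le i\le n)$ and $u_iv_i$ $(1\le i\le n+1)$. Let $B_n^2=K_2\boxtimes B_n$ be its strong prism, where in the strong product $G\boxtimes H$ two distinct vertices $(x,y),(x',y')$ of $V(G)\times V(H)$ are adjacent if and only if $x,x'$ are equal or adjacent in $G$ and $y,y'$ are equal or adjacent in $H$. For a connected graph $G$ let $Kf^*(G)=\sum_{\{i,j\}} d_i d_j r_{ij}$ be its degree-Kirchhoff index, where the sum runs over all unordered pairs of distinct vertices, $d_i$ is the degree of $i$, and $r_{ij}$ is the resistance distance, i.e. the effective resistance between $i$ and $j$ when every edge of $G$ is a unit resistor. Then $$ Kf^*(B_n^2)=\frac{\sqrt3\,(7n-9)(7n+3)\left[(2+\sqrt3)^{n+1}+(2-\sqrt3)^{n+1}\right]-4(7n+3)\left[(2+\sqrt3)^{n}-(2-\sqrt3)^{n}\right]}{3\left[(2+\sqrt3)^{n+1}-(2-\sqrt3)^{n+1}\right]}+\frac{49}{3}n^3+70n^2+141n+46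 . $$ -/

import Mathlib

open scoped Matrix

/-- The strong product `G ⊠ H`: two distinct vertices `(u₁, v₁)`, `(u₂, v₂)` are adjacent iff
`u₁, u₂` are equal or adjacent in `G` and `v₁, v₂` are equal or adjacent in `H`. -/
def strongProduct {V W : Type*} (G : SimpleGraph V) (H : SimpleGraph W) :
    SimpleGraph (V × W) where
  Adj x y := x ≠ y ∧ (x.1 = y.1 ∨ G.Adj x.1 y.1) ∧ (x.2 = y.2 ∨ H.Adj x.2 y.2)
  symm := ⟨fun _ _ h => ⟨h.1.symm, h.2.1.imp Eq.symm fun a => a.symm,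
    h.2.2.imp Eq.symm fun a => a.symm⟩⟩
  loopless := ⟨fun _ h => h.1 rfl⟩

/-- The linear polyomino chain `B_n` with `n` squares: two paths `u_1 … u_{n+1}` and
`v_1 … v_{n+1}` joined by the rungs `u_i v_i`. The vertices `u_i`, `v_i` are
`(0, i - 1)`, `(1, i - 1)`. -/
def linearPolyominoChain (n : ℕ) : SimpleGraph (Fin 2 × Fin (n + 1)) where
  Adj x y := (x.1 = y.1 ∧ (x.2.val + 1 = y.2.val ∨ y.2.val + 1 = x.2.val)) ∨
    (x.1 ≠ y.1 ∧ x.2 = y.2)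
  symm := ⟨fun _ _ h => h.imp (fun h => ⟨h.1.symm, h.2.symm⟩) fun h => ⟨h.1.symm, h.2.symm⟩⟩
  loopless := ⟨fun _ h => by rcases h with ⟨-, h⟩ | ⟨h, -⟩ <;> [omega; exact h rfl]⟩

/-- The strong prism `B_n^2 = K_2 ⊠ B_n` of the linear polyomino chain. -/
def strongPrismChain (n : ℕ) : SimpleGraph (Fin 2 × (Fin 2 × Fin (n + 1))) :=
  strongProduct (⊤ : SimpleGraph (Fin 2)) (linearPolyominoChain n)

open Classical in
/-- `v` is a potential on the network with a unit resistor on every edge of `G` when a unit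
current enters at `i` and leaves at `j`: by Ohm's law the current from `x` to a neighbour `y` is
`v x - v y`, and Kirchhoff's current law says that the net current out of every vertex `x`,
that is `(L v) x` with `L = D - A`, is the current supplied at `x`. -/
def IsUnitCurrentPotential {V : Type*} [Fintype V] (G : SimpleGraph V) (i j : V)
    (v : V → ℝ) : Prop :=
  G.lapMatrix ℝ *ᵥ v = Pi.single i 1 - Pi.single j 1

/-- The potential difference between source and sink does not depend on the potential. -/
theorem IsUnitCurrentPotential.sub_eq_sub {V : Type*} [Fintype V] {G : SimpleGraph V} {i j : V}
    {v w : V → ℝ} (hv : IsUnitCurrentPotential G i j v) (hw : IsUnitCurrentPotential G i j w) :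
    v i - v j = w i - w j := by
  classical
  unfold IsUnitCurrentPotential at hv hw
  have key : w ⬝ᵥ (G.lapMatrix ℝ *ᵥ v) = v ⬝ᵥ (G.lapMatrix ℝ *ᵥ w) := by
    rw [Matrix.dotProduct_mulVec, ← Matrix.mulVec_transpose, (G.isSymm_lapMatrix ℝ).eq,
      dotProduct_comm]
  have h1 : w ⬝ᵥ (Pi.single i 1 - Pi.single j 1) = v ⬝ᵥ (Pi.single i 1 - Pi.single j 1) := by
    convert key using 2
    · rw [← hv]
    · rw [← hw]
  simpa [dotProduct_sub, eq_comm] using h1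

/-- In a connected graph such a potential exists. -/
theorem exists_isUnitCurrentPotential {V : Type*} [Fintype V] {G : SimpleGraph V}
    (hG : G.Connected) (i j : V) : ∃ v, IsUnitCurrentPotential G i j v := by
  classical
  have := hG.nonempty
  have hcol : ∀ v : V → ℝ, ∑ x, (G.lapMatrix ℝ *ᵥ v) x = 0 := fun v => by
    have : (fun _ => (1 : ℝ)) ⬝ᵥ (G.lapMatrix ℝ *ᵥ v) = 0 := by
      rw [Matrix.dotProduct_mulVec, ← Matrix.mulVec_transpose, (G.isSymm_lapMatrix ℝ).eq,
        G.lapMatrix_mulVec_const_eq_zero, zero_dotProduct]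
    simpa [dotProduct] using this
  let T : (V → ℝ) →ₗ[ℝ] (V → ℝ) :=
    { toFun := fun v => G.lapMatrix ℝ *ᵥ v + fun _ => ∑ y, v y
      map_add' := fun v w => by
        ext x; simp [Matrix.mulVec_add, Finset.sum_add_distrib]; ring
      map_smul' := fun c v => by
        ext x; simp [Matrix.mulVec_smul, Finset.mul_sum, mul_add] }
  have hsum : ∀ v, ∑ x, T v x = 0 → ∑ y, v y = 0 := fun v h => by
    have h' : ∑ x, ((G.lapMatrix ℝ *ᵥ v) x + ∑ y, v y) = 0 := h
    rw [Finset.sum_add_distrib, hcol, zero_add, Finset.sum_const, Finset.card_univ,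
      nsmul_eq_mul] at h'
    exact (mul_eq_zero.1 h').resolve_left (by exact_mod_cast Fintype.card_ne_zero)
  have hT : ∀ v, ∑ y, v y = 0 → T v = G.lapMatrix ℝ *ᵥ v := fun v h => by
    ext x; simp [T, h]
  have hinj : Function.Injective T := by
    rw [← LinearMap.ker_eq_bot, LinearMap.ker_eq_bot']
    intro v hv
    have h0 := hsum v (by simp [hv])
    rw [hT v h0, G.lapMatrix_mulVec_eq_zero_iff_forall_reachable] at hv
    ext x
    have hc : ∑ y, v y = ∑ _y : V, v x :=
      Finset.sum_congr rfl fun y _ => hv y x (hG.preconnected y x)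
    rw [h0, Finset.sum_const, Finset.card_univ, nsmul_eq_mul] at hc
    exact (mul_eq_zero.1 hc.symm).resolve_left (by exact_mod_cast Fintype.card_ne_zero)
  obtain ⟨v, hv⟩ := LinearMap.injective_iff_surjective.1 hinj
    (Pi.single i 1 - Pi.single j 1)
  have h0 := hsum v (by simp [hv])
  refine ⟨v, ?_⟩
  rw [hT v h0] at hv
  unfold IsUnitCurrentPotential
  convert hv

open Classical in
/-- The resistance distance `r_{ij}` (effective resistance between `i` and `j` when every edge is
a unit resistor): the potential difference between `i` and `j` under a unit current from `i` to
`j`. It is meant for vertices in the same component; otherwise the value is the placeholder `0`. -/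
noncomputable def resistanceDist {V : Type*} [Fintype V] (G : SimpleGraph V) (i j : V) : ℝ :=
  if h : ∃ v, IsUnitCurrentPotential G i j v then h.choose i - h.choose j else 0

theorem IsUnitCurrentPotential.resistanceDist_eq {V : Type*} [Fintype V] {G : SimpleGraph V}
    {i j : V} {v : V → ℝ} (hv : IsUnitCurrentPotential G i j v) :
    resistanceDist G i j = v i - v j := by
  have h : ∃ v, IsUnitCurrentPotential G i j v := ⟨v, hv⟩
  rw [resistanceDist, dif_pos h]
  exact h.choose_spec.sub_eq_sub hv

theorem resistanceDist_comm {V : Type*} [Fintype V] (G : SimpleGraph V) (i j : V) :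
    resistanceDist G i j = resistanceDist G j i := by
  have key : ∀ {a b : V} {v : V → ℝ}, IsUnitCurrentPotential G a b v →
      IsUnitCurrentPotential G b a (-v) := fun {a b v} h => by
    unfold IsUnitCurrentPotential at h ⊢
    rw [Matrix.mulVec_neg, h, neg_sub]
  by_cases h : ∃ v, IsUnitCurrentPotential G i j v
  · obtain ⟨v, hv⟩ := h
    rw [hv.resistanceDist_eq, (key hv).resistanceDist_eq]
    simp only [Pi.neg_apply]
    ring
  · have h' : ¬ ∃ v, IsUnitCurrentPotential G j i v := fun ⟨v, hv⟩ => h ⟨-v, key hv⟩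
    rw [resistanceDist, resistanceDist, dif_neg h, dif_neg h']

open Classical in
/-- The degree-Kirchhoff index `Kf^*(G) = ∑_{ {i, j} } d_i d_j r_{ij}`, the sum over all unordered
pairs of distinct vertices. -/
noncomputable def degreeKirchhoffIndex {V : Type*} [Fintype V] (G : SimpleGraph V) : ℝ :=
  ∑ p : Sym2 V with ¬ p.IsDiag,
    Sym2.lift ⟨fun i j => (G.degree i : ℝ) * (G.degree j : ℝ) * resistanceDist G i j,
      fun i j => by
        dsimp only
        rw [resistanceDist_comm G i j, mul_comm (G.degree i : ℝ)]⟩ p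

/-! If columns `g y` satisfy L (g y) = e_y - c with c independent of y, then g x - g y is a unit
current potential, so r_xy = g_xx + g_yy - g_xy - g_yx and Kf* = (∑ d_x)(∑ d_x g_xx) - ∑∑ d_x d_y
g_xy. The task is to find such a g (`chainGreen`) and evaluate the two sums.

Vertices are (a, b, i), and L splits under the flips of a and b. On functions odd in a it is
multiplication by d + 1, since (0, b, i) and (1, b, i) are adjacent twins. On functions even in a it
is twice an operator on the path 0, …, n: the path Laplacian if even in b, and that Laplacian plus 2
if odd in b. The three inverses are a diagonal matrix, -|i - j|/2 (up to the common vector c), and a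
product of solutions of p(i+2) = 4p(i+1) - p(i), whose characteristic roots are 2 ± √3.

Degrees depend on i alone, so the odd parts drop out of the double sum, which is polynomial in n; 2
± √3 enters only through the diagonal. -/

/-! ### The degree-Kirchhoff index from a generalised inverse -/

theorem Sym2.sum_filter_not_isDiag {V : Type*} [Fintype V] [DecidableEq V] (p : Sym2 V → ℝ)
    [DecidablePred fun q : Sym2 V => ¬ q.IsDiag] :
    ∑ q : Sym2 V with ¬ q.IsDiag, p q = (∑ i, ∑ j, if i = j then 0 else p s(i, j)) / 2 := by
  -- An auxiliary linear order selects one ordered pair from each unordered one.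
  let e := Fintype.equivFin V
  let _ : LinearOrder V := LinearOrder.lift' e e.injective
  have h := Finset.sum_sym2_filter_not_isDiag (Finset.univ : Finset V) p
  have hsum : ∑ i, ∑ j, (if i = j then 0 else p s(i, j)) =
      ∑ x ∈ (Finset.univ : Finset V).offDiag, p s(x.1, x.2) := by
    rw [← Fintype.sum_prod_type' (f := fun i j => if i = j then 0 else p s(i, j)),
      ← Finset.sum_subset (Finset.subset_univ (Finset.univ : Finset V).offDiag)]
    · exact Finset.sum_congr rfl fun x hx => if_neg (by simpa using hx)
    · intro x _ hx
      exact if_pos (by simpa using hx)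
  have hswap : ∑ x ∈ (Finset.univ : Finset V).offDiag with ¬ x.1 < x.2, p s(x.1, x.2) =
      ∑ x ∈ (Finset.univ : Finset V).offDiag with x.1 < x.2, p s(x.1, x.2) := by
    refine Finset.sum_nbij' Prod.swap Prod.swap ?_ ?_ ?_ ?_ ?_
    · rintro ⟨i, j⟩ hx
      simp only [Finset.mem_filter, Finset.mem_offDiag, not_lt] at hx
      simp only [Finset.mem_filter, Finset.mem_offDiag, Prod.swap]
      exact ⟨⟨hx.1.2.1, hx.1.1, hx.1.2.2.symm⟩, lt_of_le_of_ne hx.2 hx.1.2.2.symm⟩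
    · rintro ⟨i, j⟩ hx
      simp only [Finset.mem_filter, Finset.mem_offDiag] at hx
      simp only [Finset.mem_filter, Finset.mem_offDiag, Prod.swap]
      exact ⟨⟨hx.1.2.1, hx.1.1, hx.1.2.2.symm⟩, not_lt.2 hx.2.le⟩
    · intros; rfl
    · intros; rfl
    · rintro ⟨i, j⟩ _
      exact congrArg p Sym2.eq_swap
  rw [hsum, ← Finset.sum_filter_add_sum_filter_not _ fun x : V × V => x.1 < x.2, hswap, ← h]
  have huniv : (Finset.univ : Finset V).sym2 = Finset.univ := by ext; simp
  rw [huniv, ← two_mul, mul_div_cancel_left₀ _ (two_ne_zero)]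
  exact Finset.sum_congr (by ext; simp) fun _ _ => rfl

open Classical in
/-- The resistance distance in terms of a generalised inverse of the Laplacian matrix. -/
theorem resistanceDist_eq_of_lapMatrix_mulVec {V : Type*} [Fintype V] [DecidableEq V]
    {G : SimpleGraph V} {g : V → V → ℝ} {c : V → ℝ} (hg : ∀ y, G.lapMatrix ℝ *ᵥ g y = Pi.single y 1 - c) (i j : V) :
    resistanceDist G i j = g i i + g j j - g i j - g j i := by
  have h : IsUnitCurrentPotential G i j (g i - g j) := by
    unfold IsUnitCurrentPotential
    have h := Matrix.mulVec_sub (G.lapMatrix ℝ) (g i) (g j)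
    rw [hg, hg, sub_sub_sub_cancel_right] at h
    convert h
  rw [h.resistanceDist_eq]
  simp only [Pi.sub_apply]
  ring

open Classical in
theorem degreeKirchhoffIndex_eq_of_lapMatrix_mulVec {V : Type*} [Fintype V] [DecidableEq V]
    {G : SimpleGraph V} {g : V → V → ℝ} {c : V → ℝ} (hg : ∀ y, G.lapMatrix ℝ *ᵥ g y = Pi.single y 1 - c) :
    degreeKirchhoffIndex G = (∑ x, (G.degree x : ℝ)) * (∑ x, G.degree x * g x x) -
      ∑ x, ∑ y, G.degree x * G.degree y * g x y := by
  have h1 : degreeKirchhoffIndex G =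
      (∑ x, ∑ y, (G.degree x : ℝ) * G.degree y * (g x x + g y y - g x y - g y x)) / 2 := by
    rw [degreeKirchhoffIndex, Sym2.sum_filter_not_isDiag]
    congr 1
    refine Finset.sum_congr rfl fun x _ => Finset.sum_congr rfl fun y _ => ?_
    split_ifs with hxy
    · subst hxy; ring
    · rw [Sym2.lift_mk]
      simp only [resistanceDist_eq_of_lapMatrix_mulVec hg]
  have h2 : ∑ x, ∑ y, (G.degree x : ℝ) * G.degree y * g y x =
      ∑ x, ∑ y, (G.degree x : ℝ) * G.degree y * g x y := by
    rw [Finset.sum_comm]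
    exact Finset.sum_congr rfl fun x _ => Finset.sum_congr rfl fun y _ => by ring
  have h3 : ∑ x, ∑ y, (G.degree x : ℝ) * G.degree y * g x x =
      (∑ x, (G.degree x : ℝ)) * (∑ x, G.degree x * g x x) := by
    rw [mul_comm, Finset.sum_mul_sum]
    exact Finset.sum_congr rfl fun x _ => Finset.sum_congr rfl fun y _ => by ring
  have h4 : ∑ x, ∑ y, (G.degree x : ℝ) * G.degree y * g y y =
      (∑ x, (G.degree x : ℝ)) * (∑ x, G.degree x * g x x) := by
    rw [Finset.sum_mul_sum]
    exact Finset.sum_congr rfl fun x _ => Finset.sum_congr rfl fun y _ => by ring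
  rw [h1]
  simp only [mul_sub, mul_add, Finset.sum_sub_distrib, Finset.sum_add_distrib]
  rw [h2, h3, h4]
  ring

/-! ### Neighbours and degrees in the strong prism -/

theorem strongPrismChain_adj_iff {n : ℕ} (a b a' b' : Fin 2) (i i' : Fin (n + 1)) :
    (strongPrismChain n).Adj (a, b, i) (a', b', i') ↔
      if b = b' then i.val + 1 = i'.val ∨ i'.val + 1 = i.val ∨ (i = i' ∧ a ≠ a') else i = i' := by
  simp only [strongPrismChain, strongProduct, linearPolyominoChain, SimpleGraph.top_adj, ne_eq,
    Prod.mk.injEq, Fin.ext_iff]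
  split_ifs <;> omega

/-- The sum of `f` over the neighbours of `i` in the path `0, …, n`. -/
def pathNeighborSum (n : ℕ) (f : ℕ → ℝ) (i : ℕ) : ℝ :=
  (if i < n then f (i + 1) else 0) + if 0 < i then f (i - 1) else 0

theorem sum_ite_succ_eq_or {n : ℕ} (f : ℕ → ℝ) (i : Fin (n + 1)) :
    ∑ j : Fin (n + 1), (if i.val + 1 = j.val ∨ j.val + 1 = i.val then f j else 0) =
      pathNeighborSum n f i := by
  have h : ∀ j : Fin (n + 1), (if i.val + 1 = j.val ∨ j.val + 1 = i.val then f j else 0) =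
      (if i.val + 1 = j.val then f j else 0) + if j.val + 1 = i.val then f j else 0 := fun j => by
    split_ifs <;> first | omega | simp
  have hi := i.isLt
  rw [Finset.sum_congr rfl fun j _ => h j, Finset.sum_add_distrib, pathNeighborSum]
  congr 1
  · rw [Fin.sum_univ_eq_sum_range (fun j => if i.val + 1 = j then f j else 0), Finset.sum_ite_eq]
    simp
  · rw [Fin.sum_univ_eq_sum_range (fun j => if j + 1 = i.val then f j else 0)]
    rcases hk : i.val with _ | k
    · simp
    · have hkn : k < n + 1 := by omega
      simp [hkn]

open Classical in
-- The three kinds of neighbour are the twin, both vertices across the rung, and both copies of each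
-- path neighbour. This form makes the block decomposition of L visible.
theorem sum_neighborFinset_strongPrismChain {n : ℕ} (F : Fin 2 → Fin 2 → ℕ → ℝ) (a b : Fin 2)
    (i : Fin (n + 1)) :
    ∑ y ∈ (strongPrismChain n).neighborFinset (a, b, i), F y.1 y.2.1 y.2.2 =
      F (a + 1) b i + ∑ a', (F a' (b + 1) i + pathNeighborSum n (F a' b) i) := by
  have key : ∀ a' b', ∑ i' : Fin (n + 1),
      (if (strongPrismChain n).Adj (a, b, i) (a', b', i') then F a' b' i' else 0) =
      if b = b' then pathNeighborSum n (F a' b') i + (if a = a' then 0 else F a' b' i)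
        else F a' b' i := by
    intro a' b'
    by_cases hb : b = b'
    · have h : ∀ i' : Fin (n + 1),
          (if (strongPrismChain n).Adj (a, b, i) (a', b', i') then F a' b' i' else 0) =
          (if i.val + 1 = i'.val ∨ i'.val + 1 = i.val then F a' b' i' else 0) +
            if i = i' then (if a = a' then 0 else F a' b' i) else 0 := fun i' => by
        rw [strongPrismChain_adj_iff]
        by_cases hi : i = i'
        · subst hi; simp [hb]
        · simp [hb, hi]
      rw [if_pos hb, Finset.sum_congr rfl fun i' _ => h i', Finset.sum_add_distrib,
        sum_ite_succ_eq_or, Finset.sum_ite_eq]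
      simp
    · simp [strongPrismChain_adj_iff, hb]
  rw [SimpleGraph.neighborFinset_eq_filter, Finset.sum_filter]
  simp only [Fintype.sum_prod_type, Fin.sum_univ_two, key]
  fin_cases a <;> fin_cases b <;> simp <;> ring

/-- The degree of the vertices of `strongPrismChain n` in position `i`. -/
noncomputable def chainDegree (n i : ℕ) : ℝ :=
  7 - 2 * (if i = 0 then 1 else 0) - 2 * (if i = n then 1 else 0)

open Classical in
theorem degree_strongPrismChain {n : ℕ} (a b : Fin 2) (i : Fin (n + 1)) :
    ((strongPrismChain n).degree (a, b, i) : ℝ) = chainDegree n i := by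
  have h := sum_neighborFinset_strongPrismChain (n := n) (fun _ _ _ => 1) a b i
  simp only [Finset.sum_const, SimpleGraph.card_neighborFinset_eq_degree, nsmul_eq_mul,
    mul_one] at h
  have hi := i.isLt
  rw [h]
  simp only [pathNeighborSum, chainDegree]
  split_ifs <;> first | omega | norm_num

/-! ### Green functions on the path -/

/-- The slope of -|k - j|/2 drops from 1/2 to -1/2 at j: a unit source there, with half the current
leaving at each end. The sink is the same for every j, as a generalised inverse requires. -/
theorem mul_sub_pathNeighborSum_abs {n i j : ℕ} (hi : i ≤ n) (hj : j ≤ n) :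
    (2 - (if i = 0 then 1 else 0) - (if i = n then 1 else 0)) * (-|(i : ℝ) - j| / 2) -
        pathNeighborSum n (fun k => -|(k : ℝ) - j| / 2) i =
      (if i = j then 1 else 0) -
        ((if i = 0 then 1 else 0) + (if i = n then 1 else 0)) / 2 := by
  have habs : ∀ k : ℕ, |(k : ℝ) - j| = if k ≤ j then (j : ℝ) - k else k - j := fun k => by
    split_ifs with h
    · rw [abs_sub_comm, abs_of_nonneg (sub_nonneg.2 (by exact_mod_cast h))]
    · rw [abs_of_nonneg (sub_nonneg.2 (by exact_mod_cast (not_le.1 h).le))]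
  simp only [pathNeighborSum, habs]
  rcases i with _ | i
  · rcases n.eq_zero_or_pos with rfl | hn
    · obtain rfl : j = 0 := by omega
      simp
    · rcases j with _ | j
      · simp [hn, hn.ne]
        norm_num
      · simp [hn, hn.ne]
        ring
  · rcases lt_trichotomy (i + 1) j with h | rfl | h
    · have h1 : i + 1 < n := by omega
      have h2 : i + 1 + 1 ≤ j := h
      have h3 : i ≤ j := by omega
      simp [h1, h2, h3, h.le, h.ne, h1.ne]
      ring
    · rcases hj.lt_or_eq with h1 | rfl
      · simp [h1, h1.ne]
      · simp
        ring
    · have h0 : ¬ i + 1 ≤ j := by omega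
      have h2 : ¬ i + 1 + 1 ≤ j := by omega
      have h3 : (if i ≤ j then (j : ℝ) - i else i - j) = i - j := by
        split_ifs with h'
        · obtain rfl : i = j := by omega
          simp
        · rfl
      rcases hi.lt_or_eq with h1 | h1
      · simp [h0, h1, h2, h3, h1.ne, h.ne']
        ring
      · subst h1
        simp [h0, h3, h.ne']
        ring

/-- The solution of `p (i + 2) = 4 * p (i + 1) - p i` with `p 0 = 1` and `p 1 = 3`. -/
noncomputable def rungSeq (i : ℕ) : ℝ :=
  (3 + √3) / 6 * (2 + √3) ^ i + (3 - √3) / 6 * (2 - √3) ^ i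

theorem sq_sqrt_three : √3 ^ 2 = 3 := Real.sq_sqrt (by norm_num)

theorem rungSeq_zero : rungSeq 0 = 1 := by simp only [rungSeq]; ring

theorem rungSeq_one : rungSeq 1 = 3 := by
  simp only [rungSeq]; linear_combination (1 / 3) * sq_sqrt_three

theorem rungSeq_add_two (i : ℕ) : rungSeq (i + 2) = 4 * rungSeq (i + 1) - rungSeq i := by
  simp only [rungSeq, pow_succ]
  linear_combination ((3 + √3) / 6 * (2 + √3) ^ i + (3 - √3) / 6 * (2 - √3) ^ i) * sq_sqrt_three

theorem rungSeq_succ_sub (n : ℕ) :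
    rungSeq (n + 1) - rungSeq n = √3 / 3 * ((2 + √3) ^ (n + 1) - (2 - √3) ^ (n + 1)) := by
  simp only [rungSeq, pow_succ]
  linear_combination (-1 / 6 * ((2 + √3) ^ n + (2 - √3) ^ n)) * sq_sqrt_three

theorem pow_sub_pow_pos (n : ℕ) : 0 < (2 + √3) ^ (n + 1) - (2 - √3) ^ (n + 1) := by
  have h0 : 0 < √3 := by positivity
  have h2 : √3 < 2 := by nlinarith [sq_sqrt_three]
  exact sub_pos.2 (pow_lt_pow_left₀ (by linarith) (by linarith) (by omega))

theorem rungSeq_succ_sub_pos (n : ℕ) : 0 < rungSeq (n + 1) - rungSeq n := by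
  rw [rungSeq_succ_sub]
  have := pow_sub_pow_pos n
  positivity

/-- By the recurrence, the left side is a discrete Wronskian of p(k) and p(i + m - k), hence depends
only on i + m; i = 0 gives its value. It normalises `rungGreen`. -/
theorem rungSeq_mul_add_mul (i m : ℕ) :
    rungSeq i * rungSeq (m + 1) + rungSeq (i + 1) * rungSeq m - 4 * (rungSeq i * rungSeq m) =
      rungSeq (i + m + 1) - rungSeq (i + m) := by
  have h := sq_sqrt_three
  have h3 : √3 ^ 3 = 3 * √3 := by linear_combination √3 * h
  simp only [rungSeq, pow_succ, pow_add]
  ring_nf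
  rw [h3, h]
  ring

/-- The recurrence holds in the interior, and p(1) = 3p(0) is the boundary condition at 0. The
condition at n fails, so i < n is essential. -/
theorem mul_sub_pathNeighborSum_rungSeq_le {n i j : ℕ} (hij : i < j) (hj : j ≤ n) :
    (4 - (if i = 0 then 1 else 0) - (if i = n then 1 else 0)) * rungSeq i -
      pathNeighborSum n rungSeq i = 0 := by
  have h : i < n := by omega
  rcases i with _ | i
  · simp [pathNeighborSum, h, h.ne, rungSeq_zero, rungSeq_one]
    norm_num
  · simp [pathNeighborSum, h, h.ne, rungSeq_add_two]

theorem pathNeighborSum_congr {n i : ℕ} {f g : ℕ → ℝ} (h₁ : i < n → f (i + 1) = g (i + 1))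
    (h₂ : 0 < i → f (i - 1) = g (i - 1)) : pathNeighborSum n f i = pathNeighborSum n g i := by
  unfold pathNeighborSum
  congr 1
  · exact ite_congr rfl h₁ fun _ => rfl
  · exact ite_congr rfl h₂ fun _ => rfl

theorem pathNeighborSum_linear (n i : ℕ) (c d : ℝ) (f g : ℕ → ℝ) :
    pathNeighborSum n (fun k => c * f k + d * g k) i =
      c * pathNeighborSum n f i + d * pathNeighborSum n g i := by
  unfold pathNeighborSum
  split_ifs <;> ring

theorem pathNeighborSum_const_mul (n i : ℕ) (c : ℝ) (f : ℕ → ℝ) :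
    pathNeighborSum n (fun k => c * f k) i = c * pathNeighborSum n f i := by
  unfold pathNeighborSum
  split_ifs <;> ring

theorem pathNeighborSum_reflect {n i : ℕ} (hi : i ≤ n) (f : ℕ → ℝ) :
    pathNeighborSum n (fun k => f (n - k)) i = pathNeighborSum n f (n - i) := by
  have h1 : (0 < n - i) = (i < n) := propext (by omega)
  have h2 : (n - i < n) = (0 < i) := propext (by omega)
  simp only [pathNeighborSum, h1, h2]
  rw [add_comm]
  congr 1
  refine ite_congr rfl (fun h => congrArg f ?_) fun _ => rfl
  omega

/-- The inverse of the Laplacian matrix of the path `0, …, n` plus twice the identity. -/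
noncomputable def rungGreen (n i j : ℕ) : ℝ :=
  rungSeq (min i j) * rungSeq (n - max i j) / (rungSeq (n + 1) - rungSeq n)

theorem mul_sub_pathNeighborSum_rungGreen {n i j : ℕ} (hi : i ≤ n) (hj : j ≤ n) :
    (4 - (if i = 0 then 1 else 0) - (if i = n then 1 else 0)) * rungGreen n i j -
        pathNeighborSum n (fun k => rungGreen n k j) i =
      if i = j then 1 else 0 := by
  have hW := (rungSeq_succ_sub_pos n).ne'
  have hle : ∀ k ≤ j, rungGreen n k j =
      rungSeq (n - j) / (rungSeq (n + 1) - rungSeq n) * rungSeq k := fun k hk => by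
    rw [rungGreen, min_eq_left hk, max_eq_right hk]; ring
  have hge : ∀ k, j ≤ k → rungGreen n k j =
      rungSeq j / (rungSeq (n + 1) - rungSeq n) * rungSeq (n - k) := fun k hk => by
    rw [rungGreen, min_eq_right hk, max_eq_left hk]; ring
  rcases lt_trichotomy i j with h | rfl | h
  · rw [hle i h.le, pathNeighborSum_congr (g := fun k => _ * rungSeq k)
      (fun _ => hle _ h) (fun _ => hle _ (by omega)), pathNeighborSum_const_mul, if_neg h.ne]
    linear_combination (rungSeq (n - j) / (rungSeq (n + 1) - rungSeq n)) *
      mul_sub_pathNeighborSum_rungSeq_le h hj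
  · rw [if_pos rfl, pathNeighborSum, hle i le_rfl, hge (i + 1) (by omega), hle (i - 1) (by omega)]
    have key := rungSeq_mul_add_mul i (n - i)
    rw [Nat.add_sub_cancel' hi] at key
    -- At an end the missing neighbour contributes 0 and the coefficient 4 drops to 3, so `e1` and
    -- `e2` extend the recurrence to the boundary via p(1) = 3p(0).
    have e1 : (if i < n then rungSeq (n - (i + 1)) else 0) =
        (4 - if i = n then 1 else 0) * rungSeq (n - i) - rungSeq (n - i + 1) := by
      rcases hi.lt_or_eq with h | rfl
      · obtain ⟨m, rfl⟩ := Nat.exists_eq_add_of_lt h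
        rw [if_pos h, if_neg h.ne, show i + m + 1 - (i + 1) = m by omega,
          show i + m + 1 - i = m + 1 by omega, rungSeq_add_two]
        ring
      · simp [rungSeq_zero, rungSeq_one]
        norm_num
    have e2 : (if 0 < i then rungSeq (i - 1) else 0) =
        (4 - if i = 0 then 1 else 0) * rungSeq i - rungSeq (i + 1) := by
      rcases i with _ | i
      · simp [rungSeq_zero, rungSeq_one]
        norm_num
      · simp [rungSeq_add_two]
    rw [← mul_ite_zero, ← mul_ite_zero, e1, e2, eq_comm]
    field_simp
    linear_combination -key
  · rw [hge i h.le, pathNeighborSum_congr (g := fun k => _ * rungSeq (n - k))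
      (fun _ => hge _ (by omega)) (fun _ => hge _ (by omega)), pathNeighborSum_const_mul,
      pathNeighborSum_reflect hi, if_neg h.ne']
    have key := mul_sub_pathNeighborSum_rungSeq_le (n := n) (i := n - i) (j := n - j)
      (by omega) (by omega)
    have h1 : (n - i = 0) = (i = n) := propext (by omega)
    have h2 : (n - i = n) = (i = 0) := propext (by omega)
    simp only [h1, h2] at key
    linear_combination (rungSeq j / (rungSeq (n + 1) - rungSeq n)) * key

/-! ### The generalised inverse of the Laplacian -/

/-- The sign of the nontrivial character of `Fin 2` at `a - b`. -/
def finTwoSign (a b : Fin 2) : ℝ := if a = b then 1 else -1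

theorem finTwoSign_succ (a b : Fin 2) : finTwoSign (a + 1) b = -finTwoSign a b := by
  fin_cases a <;> fin_cases b <;> simp [finTwoSign]

theorem finTwoSign_self (a : Fin 2) : finTwoSign a a = 1 := if_pos rfl

theorem sum_finTwoSign (b : Fin 2) : ∑ a, finTwoSign a b = 0 := by
  fin_cases b <;> simp [finTwoSign]

/-- A generalised inverse of the Laplacian matrix of `strongPrismChain n`. -/
noncomputable def chainGreen (n : ℕ) (y : Fin 2 × Fin 2 × ℕ) (a b : Fin 2) (i : ℕ) : ℝ :=
  finTwoSign a y.1 * (if b = y.2.1 ∧ i = y.2.2 then 1 / (2 * (chainDegree n y.2.2 + 1)) else 0) +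
    (1 / 8) * (1 * (-|(i : ℝ) - y.2.2| / 2) + finTwoSign b y.2.1 * rungGreen n i y.2.2)

theorem chainDegree_add_one_pos (n i : ℕ) : 0 < chainDegree n i + 1 := by
  unfold chainDegree; split_ifs <;> norm_num

open Classical in
theorem lapMatrix_strongPrismChain_mulVec_chainGreen {n : ℕ} (y : Fin 2 × Fin 2 × Fin (n + 1)) :
    (strongPrismChain n).lapMatrix ℝ *ᵥ
        (fun x => chainGreen n (y.1, y.2.1, y.2.2) x.1 x.2.1 x.2.2) =
      Pi.single y 1 - fun x => ((if x.2.2.val = 0 then 1 else 0) +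
        (if x.2.2.val = n then 1 else 0)) / 8 := by
  obtain ⟨a₀, b₀, j⟩ := y
  ext ⟨a, b, i⟩
  rw [SimpleGraph.lapMatrix_mulVec_apply, sum_neighborFinset_strongPrismChain,
    degree_strongPrismChain]
  have hi : i.val ≤ n := Nat.lt_succ_iff.1 i.isLt
  have hj : j.val ≤ n := Nat.lt_succ_iff.1 j.isLt
  have hP := mul_sub_pathNeighborSum_abs hi hj
  have hH := mul_sub_pathNeighborSum_rungGreen hi hj
  have hd := (chainDegree_add_one_pos n j).ne'
  have hD : (chainDegree n i + 1) *
      (if b = b₀ ∧ i.val = j.val then 1 / (2 * (chainDegree n j + 1)) else 0) =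
      if b = b₀ ∧ i.val = j.val then 1 / 2 else 0 := by
    split_ifs with h
    · rw [h.2]; field_simp
    · simp
  have hsum : ∀ c k, ∑ a', chainGreen n (a₀, b₀, j) a' c k = 1 / 4 *
      (1 * (-|(k : ℝ) - j| / 2) + finTwoSign c b₀ * rungGreen n k j) := fun c k => by
    simp only [chainGreen]
    rw [Finset.sum_add_distrib, ← Finset.sum_mul, sum_finTwoSign]
    simp only [Finset.sum_const, Finset.card_univ, Fintype.card_fin, nsmul_eq_mul]
    push_cast; ring
  have hpath : ∑ a', pathNeighborSum n (chainGreen n (a₀, b₀, j) a' b) i =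
      1 / 4 * (1 * pathNeighborSum n (fun k => -|(k : ℝ) - j| / 2) i +
        finTwoSign b b₀ * pathNeighborSum n (fun k => rungGreen n k j) i) := by
    have h := pathNeighborSum_linear n i 1 1 (chainGreen n (a₀, b₀, j) 0 b)
      (chainGreen n (a₀, b₀, j) 1 b)
    rw [← pathNeighborSum_linear, ← pathNeighborSum_const_mul, Fin.sum_univ_two]
    simp only [one_mul] at h
    rw [← h]
    congr 1
    ext k
    rw [← Fin.sum_univ_two fun a' => chainGreen n (a₀, b₀, j) a' b k]
    exact hsum b k
  rw [Finset.sum_add_distrib, hsum, hpath]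
  simp only [chainGreen, finTwoSign_succ]
  -- The unit vector splits into a part odd in a and parts even in a that are even or odd in b. The
  -- weight 1/4, halved because L is twice a path operator there, explains the 1/8 in `chainGreen`.
  have hrhs : ((Pi.single (a₀, b₀, j) 1 : Fin 2 × Fin 2 × Fin (n + 1) → ℝ) (a, b, i)) =
      finTwoSign a a₀ * (if b = b₀ ∧ i.val = j.val then 1 / 2 else 0) +
        1 / 4 * (1 + finTwoSign b b₀) * (if i.val = j.val then 1 else 0) := by
    simp only [Pi.single_apply, Prod.mk.injEq, Fin.ext_iff (a := i), finTwoSign]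
    split_ifs <;> first | (exfalso; tauto) | norm_num
  rw [Pi.sub_apply, hrhs, ← hD]
  have hdeg : chainDegree n i = 7 - 2 * (if i.val = 0 then 1 else 0) -
    2 * (if i.val = n then 1 else 0) := rfl
  simp only [hdeg]
  linear_combination (1 / 4) * hP + (1 / 4) * finTwoSign b b₀ * hH

/-! ### Evaluation of the sums -/

theorem sum_range_chainDegree_mul (n : ℕ) (f : ℕ → ℝ) :
    ∑ i ∈ Finset.range (n + 1), chainDegree n i * f i =
      7 * ∑ i ∈ Finset.range (n + 1), f i - 2 * f 0 - 2 * f n := by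
  simp only [chainDegree, sub_mul, mul_assoc, ite_mul, one_mul, zero_mul, Finset.sum_sub_distrib,
    ← Finset.mul_sum, Finset.sum_ite_eq', Finset.mem_range]
  simp

theorem sum_range_sub (n : ℕ) :
    ∑ i ∈ Finset.range (n + 1), ((n : ℝ) - i) = n * (n + 1) / 2 := by
  induction n with
  | zero => simp
  | succ n ih =>
    rw [Finset.sum_range_succ']
    push_cast
    simp only [add_sub_add_right_eq_sub, ih]
    ring

theorem sum_range_abs_sub_right (n : ℕ) :
    ∑ i ∈ Finset.range (n + 1), |(i : ℝ) - n| = n * (n + 1) / 2 := by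
  rw [← sum_range_sub]
  refine Finset.sum_congr rfl fun i hi => ?_
  have : (i : ℝ) ≤ n := by exact_mod_cast Finset.mem_range_succ_iff.1 hi
  rw [abs_sub_comm, abs_of_nonneg (sub_nonneg.2 this)]

theorem sum_range_abs_sub_zero (n : ℕ) :
    ∑ i ∈ Finset.range (n + 1), |(i : ℝ) - (0 : ℕ)| = n * (n + 1) / 2 := by
  rw [← sum_range_abs_sub_right, ← Finset.sum_range_reflect]
  refine Finset.sum_congr rfl fun i hi => ?_
  have : i ≤ n := Finset.mem_range_succ_iff.1 hi
  rw [show n + 1 - 1 - i = n - i by omega, Nat.cast_sub this, abs_sub_comm (i : ℝ)]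
  simp

theorem sum_range_sum_range_abs_sub (n : ℕ) :
    ∑ i ∈ Finset.range (n + 1), ∑ j ∈ Finset.range (n + 1), |(i : ℝ) - j| =
      n * (n + 1) * (n + 2) / 3 := by
  induction n with
  | zero => simp
  | succ n ih =>
    have h := sum_range_abs_sub_right (n + 1)
    rw [Finset.sum_range_succ] at h
    rw [Finset.sum_range_succ]
    simp only [Finset.sum_range_succ _ (n + 1)]
    rw [Finset.sum_add_distrib, ih]
    simp only [abs_sub_comm ((n + 1 : ℕ) : ℝ)]
    rw [sub_self, abs_zero, add_zero] at h ⊢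
    rw [h]
    push_cast
    ring

theorem sum_range_chainDegree_mul_abs_sub (n : ℕ) :
    ∑ i ∈ Finset.range (n + 1), ∑ j ∈ Finset.range (n + 1),
        chainDegree n i * chainDegree n j * |(i : ℝ) - j| =
      49 * (n * (n + 1) * (n + 2) / 3) - 28 * (n * (n + 1)) + 8 * n := by
  simp only [mul_assoc, ← Finset.mul_sum]
  rw [sum_range_chainDegree_mul n fun i =>
    ∑ j ∈ Finset.range (n + 1), chainDegree n j * |(i : ℝ) - j|]
  simp only [sum_range_chainDegree_mul n fun j : ℕ => |(_ : ℝ) - j|]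
  have h := sum_range_abs_sub_zero n
  simp only [Nat.cast_zero, sub_zero, Nat.abs_cast] at h
  simp only [Finset.sum_sub_distrib, ← Finset.mul_sum, sum_range_sum_range_abs_sub,
    sum_range_abs_sub_right, abs_sub_comm (n : ℝ), sub_self, abs_zero, Nat.cast_zero, sub_zero,
    zero_sub, abs_neg, Nat.abs_cast, h]
  ring

/-- Each end has degree 5 instead of 7 and loses 7/8 - 5/6 = 1/24. For n = 0 the ends coincide, the
degree is 3, and the formula fails. -/
theorem sum_range_chainDegree_div {n : ℕ} (hn : 1 ≤ n) :
    ∑ i ∈ Finset.range (n + 1), chainDegree n i * (1 / (chainDegree n i + 1)) =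
      7 / 8 * (n + 1) - 1 / 12 := by
  have h : ∀ i, chainDegree n i * (1 / (chainDegree n i + 1)) =
      7 / 8 - (if i = 0 then 1 / 24 else 0) - if i = n then 1 / 24 else 0 := fun i => by
    unfold chainDegree
    split_ifs <;> first | omega | norm_num
  simp only [h, Finset.sum_sub_distrib, Finset.sum_ite_eq', Finset.mem_range]
  simp
  ring

/-- The squared coefficients (3 ± √3)²/36 equal (2 ± √3)/6, so the pure powers give a term constant
in i; the mixed products are geometric sums with ratio of (2 + √3) to (2 - √3) or its inverse. -/
theorem sum_range_rungSeq_mul (n : ℕ) :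
    ∑ i ∈ Finset.range (n + 1), rungSeq i * rungSeq (n - i) =
      ((n + 1) * ((2 + √3) ^ (n + 1) + (2 - √3) ^ (n + 1)) +
        √3 / 3 * ((2 + √3) ^ (n + 1) - (2 - √3) ^ (n + 1))) / 6 := by
  have h : ∀ i ∈ Finset.range (n + 1), rungSeq i * rungSeq (n - i) =
      ((2 + √3) ^ (n + 1) + (2 - √3) ^ (n + 1)) / 6 +
        ((2 + √3) ^ i * (2 - √3) ^ (n - i) +
          (2 - √3) ^ i * (2 + √3) ^ (n - i)) / 6 := fun i hi => by
    obtain ⟨m, rfl⟩ := Nat.exists_eq_add_of_le (Finset.mem_range_succ_iff.1 hi)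
    rw [show i + m - i = m by omega]
    simp only [rungSeq, pow_succ, pow_add]
    linear_combination (((2 + √3) ^ i * (2 + √3) ^ m + (2 - √3) ^ i * (2 - √3) ^ m) / 36 -
      ((2 + √3) ^ i * (2 - √3) ^ m + (2 - √3) ^ i * (2 + √3) ^ m) / 36) * sq_sqrt_three
  have h1 := (Commute.all (2 + √3) (2 - √3)).geom_sum₂_mul (n + 1)
  have h2 := (Commute.all (2 - √3) (2 + √3)).geom_sum₂_mul (n + 1)
  simp only [add_tsub_cancel_right] at h1 h2
  rw [Finset.sum_congr rfl h]
  simp only [Finset.sum_add_distrib, ← Finset.sum_div, Finset.sum_const, Finset.card_range, nsmul_eq_mul]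
  push_cast
  linear_combination (√3 / 36) * h1 - (√3 / 36) * h2 - (1 / 18) *
    ((∑ i ∈ Finset.range (n + 1), (2 + √3) ^ i * (2 - √3) ^ (n - i)) +
      ∑ i ∈ Finset.range (n + 1), (2 - √3) ^ i * (2 + √3) ^ (n - i)) * sq_sqrt_three

theorem sum_range_chainDegree_mul_rungGreen (n : ℕ) :
    ∑ i ∈ Finset.range (n + 1), chainDegree n i * rungGreen n i i =
      (7 * ∑ i ∈ Finset.range (n + 1), rungSeq i * rungSeq (n - i) - 4 * rungSeq n) /
        (rungSeq (n + 1) - rungSeq n) := by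
  rw [sum_range_chainDegree_mul]
  simp only [rungGreen, min_self, max_self, ← Finset.sum_div, tsub_zero, tsub_self, rungSeq_zero]
  ring

/-! ### Assembly of the closed formula -/

theorem sum_fin_two_prod {n : ℕ} (f : Fin 2 → Fin 2 → ℕ → ℝ) :
    ∑ x : Fin 2 × Fin 2 × Fin (n + 1), f x.1 x.2.1 x.2.2 =
      ∑ i ∈ Finset.range (n + 1), (f 0 0 i + f 0 1 i + f 1 0 i + f 1 1 i) := by
  rw [← Fin.sum_univ_eq_sum_range fun i => f 0 0 i + f 0 1 i + f 1 0 i + f 1 1 i]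
  simp only [Fintype.sum_prod_type, Fin.sum_univ_two, Finset.sum_add_distrib]
  ring

open Classical in
theorem degreeKirchhoffIndex_strongPrismChain {n : ℕ} (hn : 1 ≤ n) :
    degreeKirchhoffIndex (strongPrismChain n) =
      (28 * n + 12) * (2 * (7 / 8 * (n + 1) - 1 / 12) +
        1 / 2 * ∑ i ∈ Finset.range (n + 1), chainDegree n i * rungGreen n i i) +
      (49 * (n * (n + 1) * (n + 2) / 3) - 28 * (n * (n + 1)) + 8 * n) := by
  rw [degreeKirchhoffIndex_eq_of_lapMatrix_mulVec
    (g := fun y x => chainGreen n (y.1, y.2.1, y.2.2) x.1 x.2.1 x.2.2)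
    (c := fun x => ((if x.2.2.val = 0 then 1 else 0) + (if x.2.2.val = n then 1 else 0)) / 8)
    lapMatrix_strongPrismChain_mulVec_chainGreen]
  have hdeg : ∀ x : Fin 2 × Fin 2 × Fin (n + 1),
      ((strongPrismChain n).degree x : ℝ) = chainDegree n x.2.2 := fun x =>
    degree_strongPrismChain x.1 x.2.1 x.2.2
  simp only [hdeg]
  have h1 : ∑ x : Fin 2 × Fin 2 × Fin (n + 1), chainDegree n x.2.2 = 28 * n + 12 := by
    have h := sum_range_chainDegree_mul n fun _ => 4
    rw [sum_fin_two_prod (fun _ _ i => chainDegree n i)]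
    simp only [Finset.sum_const, Finset.card_range, nsmul_eq_mul] at h
    push_cast at h
    rw [Finset.sum_congr rfl fun i _ => show chainDegree n i + chainDegree n i + chainDegree n i +
      chainDegree n i = chainDegree n i * 4 by ring, h]
    ring
  have h2 : ∑ x : Fin 2 × Fin 2 × Fin (n + 1), chainDegree n x.2.2 *
      chainGreen n (x.1, x.2.1, x.2.2) x.1 x.2.1 x.2.2 = 2 * (7 / 8 * (n + 1) - 1 / 12) +
        1 / 2 * ∑ i ∈ Finset.range (n + 1), chainDegree n i * rungGreen n i i := by
    rw [← sum_range_chainDegree_div hn,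
      sum_fin_two_prod fun a b i => chainDegree n i * chainGreen n (a, b, i) a b i,
      Finset.mul_sum, Finset.mul_sum, ← Finset.sum_add_distrib]
    refine Finset.sum_congr rfl fun i _ => ?_
    have := (chainDegree_add_one_pos n i).ne'
    simp only [chainGreen, finTwoSign_self, and_self, if_true, sub_self, abs_zero]
    field_simp
    ring
  -- Summation over a and b kills both sign terms; the 16 remaining copies of -|i - j|/16 add up to
  -- -|i - j|.
  have h3 : ∑ x : Fin 2 × Fin 2 × Fin (n + 1), ∑ y : Fin 2 × Fin 2 × Fin (n + 1),
      chainDegree n x.2.2 * chainDegree n y.2.2 *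
        chainGreen n (x.1, x.2.1, x.2.2) y.1 y.2.1 y.2.2 =
      -(49 * (n * (n + 1) * (n + 2) / 3) - 28 * (n * (n + 1)) + 8 * n) := by
    rw [← sum_range_chainDegree_mul_abs_sub, ← Finset.sum_neg_distrib]
    have h (x : Fin 2 × Fin 2 × Fin (n + 1)) := sum_fin_two_prod (n := n) fun a b j =>
      chainDegree n x.2.2 * chainDegree n j * chainGreen n (x.1, x.2.1, x.2.2) a b j
    rw [Finset.sum_congr rfl fun x _ => h x, sum_fin_two_prod fun a b i => ∑ j ∈ Finset.range (n + 1),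
      (chainDegree n i * chainDegree n j * chainGreen n (a, b, i) 0 0 j +
        chainDegree n i * chainDegree n j * chainGreen n (a, b, i) 0 1 j +
        chainDegree n i * chainDegree n j * chainGreen n (a, b, i) 1 0 j +
        chainDegree n i * chainDegree n j * chainGreen n (a, b, i) 1 1 j)]
    refine Finset.sum_congr rfl fun i _ => ?_
    simp only [← Finset.sum_add_distrib, ← Finset.sum_neg_distrib]
    refine Finset.sum_congr rfl fun j _ => ?_
    simp only [chainGreen, finTwoSign, abs_sub_comm (j : ℝ)]
    simp
    split_ifs <;> ring
  rw [h1, h2, h3]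
  ring

theorem theorem3p4 (n : ℕ) (hn : 1 ≤ n) :
    degreeKirchhoffIndex (strongPrismChain n) =
      (√3 * (7 * (n : ℝ) - 9) * (7 * (n : ℝ) + 3) *
            ((2 + √3) ^ (n + 1) + (2 - √3) ^ (n + 1)) -
          4 * (7 * (n : ℝ) + 3) * ((2 + √3) ^ n - (2 - √3) ^ n)) /
        (3 * ((2 + √3) ^ (n + 1) - (2 - √3) ^ (n + 1))) +
      49 / 3 * (n : ℝ) ^ 3 + 70 * (n : ℝ) ^ 2 + 141 * (n : ℝ) + 46 := by
  have hW := (pow_sub_pow_pos n).ne'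
  have h3 := sq_sqrt_three
  have hs : √3 ≠ 0 := by positivity
  rw [degreeKirchhoffIndex_strongPrismChain hn, sum_range_chainDegree_mul_rungGreen,
    sum_range_rungSeq_mul, rungSeq_succ_sub]
  -- All powers are expressed through the sum `P` and difference `M` of the (n+1)-st powers, leaving
  -- a rational identity in n, √3, `P`, `M`.
  have hp : rungSeq n = ((2 + √3) ^ (n + 1) + (2 - √3) ^ (n + 1)) / 2 -
      √3 / 3 * ((2 + √3) ^ (n + 1) - (2 - √3) ^ (n + 1)) / 2 := by
    simp only [rungSeq, pow_succ]
    linear_combination (1 / 6 * ((2 + √3) ^ n + (2 - √3) ^ n)) * h3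
  have hq : (2 + √3) ^ n - (2 - √3) ^ n =
      2 * ((2 + √3) ^ (n + 1) - (2 - √3) ^ (n + 1)) -
        √3 * ((2 + √3) ^ (n + 1) + (2 - √3) ^ (n + 1)) := by
    simp only [pow_succ]
    linear_combination ((2 + √3) ^ n - (2 - √3) ^ n) * h3
  rw [hp, hq]
  set P := (2 + √3) ^ (n + 1) + (2 - √3) ^ (n + 1)
  set M := (2 + √3) ^ (n + 1) - (2 - √3) ^ (n + 1)
  have hinv : ∀ X : ℝ, X / (√3 / 3 * M) = √3 * X / M := fun X => by
    field_simp
    linear_combination -X * h3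
  rw [hinv]
  field_simp
  ring_nf
  simp only [h3]
  ring
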